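/- Let $n,d\ge 0$ be integers, $\mu,\tilde\mu\in\mathbb R^n$, let $\Sigma,\tilde\Sigma\in\mathbb R^{n\times n}$ be symmetric and put $Z=\Sigma\tilde\Sigma$. A prime denotes transposition and $A^0=I$. For $k\ge1$ let $$\kappa_k=\kappa_k(\mu,\Sigma,\tilde\mu,\tilde\Sigma)=\begin{cases}(k-1)!\,\operatorname{trace}(Z^{k/2})+\frac{k!}{2}\left(\mu'\tilde\Sigma Z^{\frac{k-2}{2}}\mu+\tilde\mu' Z^{\frac{k-2}{2}}\Sigma\tilde\mu\right)&k\text{ even},\\[1mm] k!\,\tilde\mu' Z^{\frac{k-1}{2}}\mu&k\text{ odd},\end{cases}$$ and let $$B_k(x_1,\dots,x_k)=\sum_{\substack{j_1,\dots,j_k\ge0\\ j_1+2j_2+\cdots+kj_k=k}}\frac{k!}{j_1!\cdots j_k!}\prod_{i=1}^k\left(\frac{x_i}{i!}\right)^{j_i}$$ be the complete Bell polynomials ($B_0=1$). For positive semidefinite $\Sigma,\tilde\Sigma$ let $$\Psi^{(d)}(\mu,\Sigma,\tilde\mu,\tilde\Sigma)=\left\langle \mathbb E(X^{\otimes d}),\mathbb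 E(\tilde X^{\otimes d})\right\rangle,\qquad X\sim\mathcal N(\mu,\Sigma),\quad \tilde X\sim\mathcal N(\tilde\mu,\tilde\Sigma),$$ the entrywise inner product of the $d$-th moment tensors. Then $\Psi^{(d)}=B_d(\kappa_1,\dots,\kappa_d)$ for positive semidefinite $\Sigma,\tilde\Sigma$; for other $\Sigma$ and $\tilde\Sigma$ let $\Psi^{(d)}$ denote the polynomial $B_d(\kappa_1,\dots,\kappa_d)$. Here $\partial f/\partial\Sigma$ is the matrix with entries $\partial f/\partial\Sigma_{ij}$, the $n^2$ entries of $\Sigma$ being treated as independent variables, evaluated at the given symmetric $\Sigma$. Then $\Psi^{(d)}$ is differentiable with $$\frac{\partial\Psi^{(d)}}{\partial\mu}=\sum_{k=1}^d\binom dk B_{d-k}(\kappa_1,\dots,\kappa_{d-k})\frac{\partial\kappa_k}{\partial\mu},\qquad \frac{\partial\Psi^{(d)}}{\partial\Sigma}=\sum_{k=1}^d\binom dk B_{d-k}(\kappa_1,\dots,\kappa_{d-k})\frac{\partial\kappa_k}{\partial\Sigma},$$ where, for every $k\ge1$, $$\frac{\partial\kappa_k}{\partial\mu}=\begin{cases}k!\,\tilde\Sigma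 Z^{\frac{k-2}{2}}\mu&k\text{ even},\\ k!\,(Z')^{\frac{k-1}{2}}\tilde\mu&k\text{ odd},\end{cases}\qquad \frac{\partial\kappa_k}{\partial\Sigma}=\begin{cases}\frac{k!}{2}\tilde\Sigma Z^{\frac{k-2}{2}}+\frac{k!}{2}\,(V+\tilde V)&k\text{ even},\\ k!\sum_{\ell=0}^{\frac{k-3}{2}}(Z')^\ell\tilde\mu\mu'\tilde\Sigma Z^{\frac{k-3}{2}-\ell}&k\text{ odd},\end{cases}$$ $$V=\sum_{\ell=0}^{\frac{k-4}{2}}\tilde\Sigma Z^\ell\mu\mu'\tilde\Sigma Z^{\frac{k-4}{2}-\ell},\qquad \tilde V=\sum_{\ell=0}^{\frac{k-2}{2}}(Z')^\ell\tilde\mu\tilde\mu' Z^{\frac{k-2}{2}-\ell}$$ (sums whose upper limit is $-1$ are empty). Moreover, when $\Sigma,\tilde\Sigma$ are positive semidefinite and $G$ denotes the above matrix $\partial\Psi^{(d)}/\partial\Sigma$, the Gaussian inner product $\Psi^{(d)}$ satisfies, within the cone of positive semidefinite matrices, $\Psi^{(d)}(\mu,\Sigma+H,\tilde\mu,\tilde\Sigma)=\Psi^{(d)}(\mu,\Sigma,\tilde\mu,\tilde\Sigma)+\operatorname{trace}(G'H)+o(\|H\|)$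 as $H\to0$ with $\Sigma+H$ positive semidefinite. -/

import Mathlib

open Matrix MeasureTheory ProbabilityTheory
open scoped Nat

noncomputable section

namespace GaussianInner

/-- Vectors of `ℝⁿ` with the Euclidean inner product. -/
abbrev Vec (n : ℕ) := EuclideanSpace ℝ (Fin n)

/-- Real `n × n` matrices. -/
abbrev Mat (n : ℕ) := Matrix (Fin n) (Fin n) ℝ

/-- The `d`-th moment tensor `E(X^{⊗ d})` of `X ∼ N(μ, S)`: its entry with index `(i₁, …, i_d)` is
`E(X_{i₁} ⋯ X_{i_d})`. -/
def momentTensor {n : ℕ} (d : ℕ) (μ : Vec n) (S : Mat n) (i : Fin d → Fin n) : ℝ :=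
  ∫ x, ∏ r, x (i r) ∂(multivariateGaussian μ S)

/-- The tensor inner product of the `d`-th moments of `N(μ, S)` and `N(ν, T)`. -/
def Psi {n : ℕ} (d : ℕ) (μ : Vec n) (S : Mat n) (ν : Vec n) (T : Mat n) : ℝ :=
  ∑ i : Fin d → Fin n, momentTensor d μ S i * momentTensor d ν T i

/-- The multi-indices `(j₁, …, j_k)` of nonnegative integers with `j₁ + 2 j₂ + ⋯ + k j_k = k`
(the bound `j_i ≤ k` is automatic); `j_{i+1}` is stored as `j i`. -/
def bellIndices (k : ℕ) : Finset (Fin k → ℕ) :=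
  {j ∈ Fintype.piFinset (fun _ : Fin k => Finset.range (k + 1)) |
    ∑ i : Fin k, ((i : ℕ) + 1) * j i = k}

/-- The complete Bell polynomial `B_k(x₁, …, x_k)`; only the values `x 1, …, x k` are used. -/
def bell (k : ℕ) (x : ℕ → ℝ) : ℝ :=
  ∑ j ∈ bellIndices k,
    (k ! : ℝ) / (∏ i : Fin k, ((j i)! : ℝ)) *
      ∏ i : Fin k, (x ((i : ℕ) + 1) / (((i : ℕ) + 1)! : ℝ)) ^ j i

/-- The numbers `κ_k`, `k ≥ 1`, with `Z = S T`. -/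
def kappa {n : ℕ} (μ : Vec n) (S : Mat n) (ν : Vec n) (T : Mat n) (k : ℕ) : ℝ :=
  if Even k then
    ((k - 1)! : ℝ) * trace ((S * T) ^ (k / 2)) +
      (k ! : ℝ) / 2 *
        (μ.ofLp ⬝ᵥ ((T * (S * T) ^ ((k - 2) / 2)) *ᵥ μ.ofLp) +
          ν.ofLp ⬝ᵥ (((S * T) ^ ((k - 2) / 2) * S) *ᵥ ν.ofLp))
  else
    (k ! : ℝ) * (ν.ofLp ⬝ᵥ ((S * T) ^ ((k - 1) / 2) *ᵥ μ.ofLp))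

/-- The vector claimed to be `∂κ_k/∂μ`. -/
def kappaGradMean {n : ℕ} (μ : Vec n) (S : Mat n) (ν : Vec n) (T : Mat n) (k : ℕ) : Vec n :=
  if Even k then
    WithLp.toLp 2 ((k ! : ℝ) • ((T * (S * T) ^ ((k - 2) / 2)) *ᵥ μ.ofLp))
  else
    WithLp.toLp 2 ((k ! : ℝ) • (((S * T)ᵀ ^ ((k - 1) / 2)) *ᵥ ν.ofLp))

/-- `V = ∑_{ℓ=0}^{(k-4)/2} T Z^ℓ μ μ' T Z^{(k-4)/2-ℓ}`, `k` even (empty sum for `k = 2`). -/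
def matV {n : ℕ} (μ : Vec n) (S T : Mat n) (k : ℕ) : Mat n :=
  ∑ l ∈ Finset.range ((k - 2) / 2),
    T * (S * T) ^ l * vecMulVec μ.ofLp μ.ofLp * T * (S * T) ^ ((k - 4) / 2 - l)

/-- `Ṽ = ∑_{ℓ=0}^{(k-2)/2} (Z')^ℓ ν ν' Z^{(k-2)/2-ℓ}`, `k ≥ 2` even. -/
def matVTilde {n : ℕ} (ν : Vec n) (S T : Mat n) (k : ℕ) : Mat n :=
  ∑ l ∈ Finset.range (k / 2),
    (S * T)ᵀ ^ l * vecMulVec ν.ofLp ν.ofLp * (S * T) ^ ((k - 2) / 2 - l)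

/-- The matrix claimed to be `∂κ_k/∂S`; for odd `k` the sum runs over `0 ≤ ℓ ≤ (k-3)/2`. -/
def kappaGradCov {n : ℕ} (μ : Vec n) (S : Mat n) (ν : Vec n) (T : Mat n) (k : ℕ) : Mat n :=
  if Even k then
    ((k ! : ℝ) / 2) • (T * (S * T) ^ ((k - 2) / 2)) +
      ((k ! : ℝ) / 2) • (matV μ S T k + matVTilde ν S T k)
  else
    (k ! : ℝ) • ∑ l ∈ Finset.range ((k - 1) / 2),
      (S * T)ᵀ ^ l * vecMulVec ν.ofLp μ.ofLp * T * (S * T) ^ ((k - 3) / 2 - l)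

/-- The linear functional `H ↦ ⟨G, H⟩ = trace (G' H)` on `n × n` matrices. -/
def frobeniusPairing {n : ℕ} (G : Mat n) : Mat n →L[ℝ] ℝ :=
  LinearMap.toContinuousLinearMap
    { toFun := fun H => trace (Gᵀ * H)
      map_add' := fun A B => by simp [Matrix.mul_add]
      map_smul' := fun c A => by simp }

/-- `G` is the gradient at `S` of the function `f` of all `n²` entries of a matrix: `f` is
(Fréchet) differentiable at `S` with derivative `H ↦ ⟨G, H⟩`, that is,
`G i j = ∂f/∂S_{ij}`. -/
def HasMatrixGradientAt {n : ℕ} (f : Mat n → ℝ) (G S : Mat n) : Prop :=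
  HasFDerivAt f (frobeniusPairing G) S

/-- The same for `f` restricted to a set `s` of matrices:
`f S' = f S + ⟨G, S' - S⟩ + o(‖S' - S‖)` as `S' → S` inside `s`. -/
def HasMatrixGradientWithinAt {n : ℕ} (f : Mat n → ℝ) (G : Mat n) (s : Set (Mat n))
    (S : Mat n) : Prop :=
  HasFDerivWithinAt f (frobeniusPairing G) s S

end GaussianInner

end

/-!
Let `X ∼ N(μ, S)` and `Y ∼ N(ν, T)` be independent. The inner product of the moment tensors is the
moment `E (X ⬝ Y)^d` (`psi_eq_affineExpectation`), and `X ⬝ Y = w'Jw / 2` is a quadratic form in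
the Gaussian vector `w = (X, Y)`, whose covariance `Ω` is block diagonal with blocks `S`, `T`; `J`
swaps the two halves of `w`. Gaussian expectations of polynomials are handled algebraically, as
linear functionals on `MvPolynomial` that satisfy Stein's identity
`E (w_i p) = θ_i E p + ∑ Ω_ij E (∂_j p)` (`affineExpectation_X_mul`); it reduces to integration by
parts in one variable.

Applied to `w_i q^d` and `w_i w_j q^d` with `q = w'Jw / 2`, Stein's identity gives linear
recursions in `d` whose solution is a recursion for the moments of `q`
(`quadraticForm_moment_succ`). It has the form of the recursion
`B_{d+1} = ∑ (d choose k) x_{k+1} B_{d-k}` of the complete Bell polynomials (`bell_succ`), with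
`x_{k+1} = (k! / 2) ((k + 1) θ'(JΩ)^k J θ + trace (JΩ)^{k+1})`. As `JΩ` is block antidiagonal, its
powers are explicit and `x_k = κ_k` (`kappa_succ`); the parity of `k` decides which blocks survive.
Hence `psi_eq_bell`.

The Bell recursion also yields, by induction, `∂B_d / ∂x_k = (d choose k) B_{d-k}`
(`hasFDerivAt_bell`). The gradients of `κ_k` follow from the noncommutative power rule for
`A ↦ (A T)^p`, with cyclicity of the trace, and from the symmetry of `T (S T)^p`. The chain rule
then gives the gradients of `B_d(κ_1, …, κ_d)`, and those of the Gaussian inner product, which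
agrees with it on positive semidefinite matrices.
-/

noncomputable section

namespace GaussianInner

/-! ### Complete Bell polynomials -/

/-- The functions `j` on `Fin N` with `∑ (i + 1) j_i = d`. For `N = d` these are the indices of the
Bell polynomial `B_d`; the recursion for `B_d` compares different `d` at a common `N`. -/
def weightedIndices (N d : ℕ) : Finset (Fin N → ℕ) :=
  {j ∈ Fintype.piFinset (fun _ : Fin N => Finset.range (d + 1)) |
    ∑ i : Fin N, ((i : ℕ) + 1) * j i = d}

lemma mem_weightedIndices {N d : ℕ} {j : Fin N → ℕ} :
    j ∈ weightedIndices N d ↔ ∑ i : Fin N, ((i : ℕ) + 1) * j i = d := by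
  simp only [weightedIndices, Finset.mem_filter, Fintype.mem_piFinset, Finset.mem_range,
    and_iff_right_iff_imp]
  intro h i
  have h1 : ((i : ℕ) + 1) * j i ≤ ∑ i : Fin N, ((i : ℕ) + 1) * j i :=
    Finset.single_le_sum (f := fun i : Fin N => ((i : ℕ) + 1) * j i) (fun _ _ => Nat.zero_le _)
      (Finset.mem_univ i)
  nlinarith [Nat.zero_le ((i : ℕ) * j i)]

/-- The monomial `∏ a_i ^ j_i / j_i!`. -/
def bellMonomial {N : ℕ} (a : ℕ → ℝ) (j : Fin N → ℕ) : ℝ :=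
  ∏ i : Fin N, a i ^ j i / ((j i)! : ℝ)

/-- The coefficient of `t ^ d` in `∏_{i < N} exp (a_i t ^ (i + 1))`. -/
def expCoeff (N d : ℕ) (a : ℕ → ℝ) : ℝ :=
  ∑ j ∈ weightedIndices N d, bellMonomial a j

lemma bell_eq_expCoeff (d : ℕ) (x : ℕ → ℝ) :
    bell d x = (d ! : ℝ) * expCoeff d d (fun i => x (i + 1) / ((i + 1)! : ℝ)) := by
  rw [bell, expCoeff, Finset.mul_sum]
  refine Finset.sum_congr rfl fun j _ => ?_
  rw [bellMonomial, Finset.prod_div_distrib]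
  ring

lemma expCoeff_succ {N d : ℕ} (h : d ≤ N) (a : ℕ → ℝ) :
    expCoeff (N + 1) d a = expCoeff N d a := by
  have hlast : ∀ j ∈ weightedIndices (N + 1) d, j (Fin.last N) = 0 := by
    intro j hj
    rw [mem_weightedIndices, Fin.sum_univ_castSucc] at hj
    by_contra h0
    have : 1 ≤ j (Fin.last N) := Nat.one_le_iff_ne_zero.2 h0
    simp only [Fin.val_last] at hj
    have := Nat.mul_le_mul_left (N + 1) this
    omega
  refine Finset.sum_nbij' (fun j i => j i.castSucc) (fun j => Fin.snoc j 0) ?_ ?_ ?_ ?_ ?_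
  · intro j hj
    have h0 := hlast j hj
    rw [mem_weightedIndices, Fin.sum_univ_castSucc, h0] at hj
    rw [mem_weightedIndices]
    simpa using hj
  · intro j hj
    rw [mem_weightedIndices] at hj
    rw [mem_weightedIndices, Fin.sum_univ_castSucc]
    simpa using hj
  · intro j hj
    funext i
    refine Fin.lastCases ?_ (fun i => ?_) i
    · simp [hlast j hj]
    · simp
  · intro j _
    funext i
    simp
  · intro j hj
    rw [bellMonomial, bellMonomial, Fin.prod_univ_castSucc, hlast j hj]
    simp

lemma expCoeff_of_le {N d : ℕ} (h : d ≤ N) (a : ℕ → ℝ) :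
    expCoeff N d a = expCoeff d d a := by
  induction N, h using Nat.le_induction with
  | base => rfl
  | succ N hN ih => rw [expCoeff_succ hN, ih]

/-- The `i`-th partial derivative of the generating function `∏ exp (a_i t ^ (i + 1))`, multiplied
by `a_i`, read off at the coefficient of `t ^ (d + i + 1)`. -/
lemma sum_mul_bellMonomial (N d : ℕ) (i : Fin N) (a : ℕ → ℝ) :
    ∑ j ∈ weightedIndices N (d + (i + 1)), (j i : ℝ) * bellMonomial a j =
      a i * expCoeff N d a := by
  rw [expCoeff, Finset.mul_sum,
    ← Finset.sum_filter_of_ne (p := fun j : Fin N → ℕ => j i ≠ 0)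
      (fun j _ hj h0 => hj (by simp [h0]))]
  have hsum : ∀ j : Fin N → ℕ, ∀ m : ℕ,
      ∑ l : Fin N, ((l : ℕ) + 1) * Function.update j i m l =
        (i + 1) * m + ∑ l ∈ Finset.univ.erase i, ((l : ℕ) + 1) * j l := by
    intro j m
    rw [← Finset.add_sum_erase _ _ (Finset.mem_univ i), Function.update_self]
    congr 1
    exact Finset.sum_congr rfl fun l hl => by
      rw [Function.update_of_ne (Finset.ne_of_mem_erase hl)]
  have hsum' : ∀ j : Fin N → ℕ, ∑ l : Fin N, ((l : ℕ) + 1) * j l =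
        (i + 1) * j i + ∑ l ∈ Finset.univ.erase i, ((l : ℕ) + 1) * j l := fun j =>
    (Finset.add_sum_erase _ _ (Finset.mem_univ i)).symm
  refine Finset.sum_nbij' (fun j => Function.update j i (j i - 1))
    (fun j => Function.update j i (j i + 1)) ?_ ?_ ?_ ?_ ?_
  · intro j hj
    rw [Finset.mem_filter, mem_weightedIndices, hsum'] at hj
    rw [mem_weightedIndices, hsum]
    obtain ⟨m, hm⟩ := Nat.exists_eq_succ_of_ne_zero hj.2
    rw [hm] at hj ⊢
    simp only [Nat.succ_eq_add_one, Nat.add_sub_cancel]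
    have := hj.1
    rw [Nat.succ_eq_add_one, mul_add] at this
    omega
  · intro j hj
    rw [mem_weightedIndices, hsum'] at hj
    rw [Finset.mem_filter, mem_weightedIndices, hsum, Function.update_self, mul_add]
    exact ⟨by omega, by omega⟩
  · intro j hj
    rw [Finset.mem_filter] at hj
    funext l
    by_cases hl : l = i
    · subst hl
      have := hj.2
      simp
      omega
    · simp [hl]
  · intro j hj
    funext l
    by_cases hl : l = i
    · subst hl
      simp
    · simp [hl]
  · intro j hj
    rw [Finset.mem_filter] at hj
    obtain ⟨m, hm⟩ := Nat.exists_eq_succ_of_ne_zero hj.2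
    rw [bellMonomial, bellMonomial, ← Finset.mul_prod_erase _ _ (Finset.mem_univ i),
      ← Finset.mul_prod_erase _ _ (Finset.mem_univ i), hm]
    simp only [Nat.succ_eq_add_one, Nat.add_sub_cancel, Function.update_self]
    have : ∏ l ∈ Finset.univ.erase i,
          a l ^ Function.update j i m l / ((Function.update j i m l)! : ℝ) =
        ∏ l ∈ Finset.univ.erase i, a l ^ j l / ((j l)! : ℝ) :=
      Finset.prod_congr rfl fun l hl => by
        rw [Function.update_of_ne (Finset.ne_of_mem_erase hl)]
    rw [this, Nat.factorial_succ]
    push_cast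
    field_simp
    ring

lemma bell_zero (x : ℕ → ℝ) : bell 0 x = 1 := by
  simp [bell, bellIndices]

/-- The recursion for complete Bell polynomials, i.e. the differential equation `F' = g' F` for
`F = exp g`, `g = ∑ x_k t ^ k / k!`. -/
lemma bell_succ (d : ℕ) (x : ℕ → ℝ) :
    bell (d + 1) x =
      ∑ k ∈ Finset.range (d + 1), (d.choose k : ℝ) * x (k + 1) * bell (d - k) x := by
  set a : ℕ → ℝ := fun i => x (i + 1) / ((i + 1)! : ℝ) with ha
  have h1 : ((d + 1 : ℕ) : ℝ) * expCoeff (d + 1) (d + 1) a =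
      ∑ k ∈ Finset.range (d + 1), ((k : ℝ) + 1) * (a k * expCoeff (d - k) (d - k) a) := by
    have h2 : ((d + 1 : ℕ) : ℝ) * expCoeff (d + 1) (d + 1) a =
        ∑ j ∈ weightedIndices (d + 1) (d + 1),
          ∑ i : Fin (d + 1), (((i : ℕ) : ℝ) + 1) * ((j i : ℝ) * bellMonomial a j) := by
      rw [expCoeff, Finset.mul_sum]
      refine Finset.sum_congr rfl fun j hj => ?_
      have hd := congrArg (Nat.cast : ℕ → ℝ) (mem_weightedIndices.1 hj)
      rw [← hd]
      push_cast
      rw [Finset.sum_mul]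
      exact Finset.sum_congr rfl fun i _ => by ring
    rw [h2, Finset.sum_comm,
      ← Fin.sum_univ_eq_sum_range (fun k => ((k : ℝ) + 1) * (a k * expCoeff (d - k) (d - k) a))]
    refine Finset.sum_congr rfl fun i _ => ?_
    rw [← Finset.mul_sum]
    have h3 := sum_mul_bellMonomial (d + 1) (d - i) i a
    rw [show d - (i : ℕ) + (i + 1) = d + 1 by omega] at h3
    rw [h3, expCoeff_of_le (by omega : d - (i : ℕ) ≤ d + 1)]
  rw [bell_eq_expCoeff, Nat.factorial_succ, Nat.cast_mul, mul_comm ((d + 1 : ℕ) : ℝ), mul_assoc,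
    h1, Finset.mul_sum]
  refine Finset.sum_congr rfl fun k hk => ?_
  have hk' : k ≤ d := Nat.lt_succ_iff.1 (Finset.mem_range.1 hk)
  rw [bell_eq_expCoeff, Nat.cast_choose ℝ hk', ← ha]
  simp only [ha, Nat.factorial_succ]
  have := Nat.factorial_pos k
  have := Nat.factorial_pos (d - k)
  push_cast
  field_simp

/-- The chain rule for `B_d`: its partial derivative in `x_k` is `(d choose k) B_{d-k}`. -/
lemma hasFDerivAt_bell {E : Type*} [NormedAddCommGroup E] [NormedSpace ℝ E] {x : E → ℕ → ℝ}
    {x' : ℕ → E →L[ℝ] ℝ} {e : E}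
    (hx : ∀ k, 1 ≤ k → HasFDerivAt (fun z => x z k) (x' k) e) (d : ℕ) :
    HasFDerivAt (fun z => bell d (x z))
      (∑ k ∈ Finset.Icc 1 d, ((d.choose k : ℝ) * bell (d - k) (x e)) • x' k) e := by
  have hIcc : ∀ d : ℕ, ∑ k ∈ Finset.Icc 1 d, ((d.choose k : ℝ) * bell (d - k) (x e)) • x' k =
      ∑ k ∈ Finset.range d, ((d.choose (k + 1) : ℝ) * bell (d - (k + 1)) (x e)) • x' (k + 1) := by
    intro d
    rw [← Finset.Ico_add_one_right_eq_Icc, Finset.sum_Ico_eq_sum_range, Nat.add_sub_cancel]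
    simp_rw [Nat.add_comm 1]
  rw [hIcc]
  induction d using Nat.strong_induction_on with
  | _ d ih =>
    rcases d with _ | d
    · simpa [bell_zero] using hasFDerivAt_const (1 : ℝ) e
    simp_rw [bell_succ]
    have hsum := HasFDerivAt.fun_sum (u := Finset.range (d + 1)) (fun k hk =>
      (((hx (k + 1) (by omega)).const_mul (d.choose k : ℝ)).mul
        (ih (d - k) (by omega))))
    refine hsum.congr_fderiv ?_
    ext y
    simp only [FunLike.coe_sum, Finset.sum_apply, FunLike.coe_add, FunLike.coe_smul, Pi.add_apply,
      Pi.smul_apply, smul_eq_mul, Finset.sum_add_distrib, Finset.mul_sum]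
    have hswap : ∑ j ∈ Finset.range (d + 1), ∑ k ∈ Finset.range (d - j),
          (d.choose j : ℝ) * x e (j + 1) *
            (((d - j).choose (k + 1) : ℝ) * bell (d - j - (k + 1)) (x e) * x' (k + 1) y) =
        ∑ k ∈ Finset.range d, (d.choose (k + 1) : ℝ) * bell (d - k) (x e) * x' (k + 1) y := by
      rw [Finset.sum_comm' (s' := fun k => Finset.range (d - (k + 1) + 1))
        (t' := Finset.range d) (by intro a b; simp only [Finset.mem_range]; omega)]
      refine Finset.sum_congr rfl fun k hk => ?_
      have hk' := Finset.mem_range.1 hk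
      rw [show d - k = d - (k + 1) + 1 by omega, bell_succ, Finset.mul_sum, Finset.sum_mul]
      refine Finset.sum_congr rfl fun j hj => ?_
      have hj' := Finset.mem_range.1 hj
      -- both products count pairs of disjoint subsets of sizes `j` and `k + 1`
      have hc : (d.choose j : ℝ) * ((d - j).choose (k + 1) : ℝ) =
          (d.choose (k + 1) : ℝ) * ((d - (k + 1)).choose j : ℝ) := by
        rw [Nat.cast_choose ℝ (by omega : j ≤ d), Nat.cast_choose ℝ (by omega : k + 1 ≤ d - j),
          Nat.cast_choose ℝ (by omega : k + 1 ≤ d), Nat.cast_choose ℝ (by omega : j ≤ d - (k + 1)),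
          show d - j - (k + 1) = d - (k + 1) - j by omega]
        field_simp
      rw [show d - j - (k + 1) = d - (k + 1) - j by omega]
      linear_combination (x e (j + 1) * bell (d - (k + 1) - j) (x e) * x' (k + 1) y) * hc
    rw [hswap, Finset.sum_range_succ (fun k => ((d + 1).choose (k + 1) : ℝ) * _ * _),
      Finset.sum_range_succ (fun k => bell (d - k) (x e) * _)]
    have hP : ∀ k ∈ Finset.range d,
        ((d + 1).choose (k + 1) : ℝ) * bell (d + 1 - (k + 1)) (x e) * x' (k + 1) y =
        (d.choose (k + 1) : ℝ) * bell (d - k) (x e) * x' (k + 1) y +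
          bell (d - k) (x e) * ((d.choose k : ℝ) * x' (k + 1) y) := by
      intro k _
      rw [Nat.choose_succ_succ, Nat.add_sub_add_right]
      push_cast
      ring
    rw [Finset.sum_congr rfl hP, Finset.sum_add_distrib]
    simp
    ring

/-! ### Gradients of the cumulants -/

section Gradients

variable {n : ℕ}

lemma hasGradientAt_dotProduct (c : Fin n → ℝ) (μ : Vec n) :
    HasGradientAt (fun m : Vec n => c ⬝ᵥ m.ofLp) (WithLp.toLp 2 c) μ := by
  rw [hasGradientAt_iff_hasFDerivAt]
  have h : (fun m : Vec n => c ⬝ᵥ m.ofLp) =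
      (InnerProductSpace.toDual ℝ (Vec n) (WithLp.toLp 2 c) : Vec n → ℝ) := by
    funext m
    rw [InnerProductSpace.toDual_apply_apply, EuclideanSpace.inner_eq_star_dotProduct,
      dotProduct_comm]
    rfl
  rw [h]
  exact ContinuousLinearMap.hasFDerivAt _

lemma hasGradientAt_quadraticForm {B : Mat n} (hB : B.IsSymm) (μ : Vec n) :
    HasGradientAt (fun m : Vec n => m.ofLp ⬝ᵥ (B *ᵥ m.ofLp))
      (WithLp.toLp 2 ((2 : ℝ) • (B *ᵥ μ.ofLp))) μ := by
  rw [hasGradientAt_iff_hasFDerivAt]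
  have h : (fun m : Vec n => m.ofLp ⬝ᵥ (B *ᵥ m.ofLp)) =
      fun m => inner ℝ m (toEuclideanCLM (𝕜 := ℝ) B m) := by
    funext m
    rw [inner_toEuclideanCLM]
  rw [h]
  refine ((hasFDerivAt_id μ).inner ℝ
    (toEuclideanCLM (𝕜 := ℝ) B).hasFDerivAt).congr_fderiv ?_
  ext v
  have hs : μ.ofLp ⬝ᵥ (B *ᵥ v.ofLp) = v.ofLp ⬝ᵥ (B *ᵥ μ.ofLp) := by
    rw [dotProduct_mulVec, ← mulVec_transpose, hB.eq, dotProduct_comm]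
  simp [EuclideanSpace.inner_eq_star_dotProduct]
  rw [dotProduct_comm, hs, dotProduct_comm (B *ᵥ μ.ofLp)]
  ring

lemma transpose_pow_mul {S T : Mat n} (hS : S.IsSymm) (hT : T.IsSymm) (p : ℕ) :
    (S * T)ᵀ ^ p * T = T * (S * T) ^ p := by
  rw [transpose_mul, hS.eq, hT.eq]
  induction p with
  | zero => simp
  | succ p ih => rw [pow_succ', pow_succ', mul_assoc, ih]; simp only [mul_assoc]

lemma isSymm_mul_pow {S T : Mat n} (hS : S.IsSymm) (hT : T.IsSymm) (p : ℕ) :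
    (T * (S * T) ^ p).IsSymm := by
  rw [IsSymm, transpose_mul, transpose_pow, hT.eq, transpose_pow_mul hS hT]

lemma hasGradientAt_kappa {S T : Mat n} (hS : S.IsSymm) (hT : T.IsSymm) (μ ν : Vec n) (k : ℕ) :
    HasGradientAt (fun m : Vec n => kappa m S ν T k) (kappaGradMean μ S ν T k) μ := by
  rw [hasGradientAt_iff_hasFDerivAt]
  by_cases hk : Even k
  · simp only [kappa, kappaGradMean, if_pos hk]
    have h := (hasGradientAt_quadraticForm (isSymm_mul_pow hS hT ((k - 2) / 2)) μ).hasFDerivAt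
    refine (((h.add_const _).const_mul ((k ! : ℝ) / 2)).const_add _).congr_fderiv ?_
    ext v
    simp
    ring
  · simp only [kappa, kappaGradMean, if_neg hk]
    have h := (hasGradientAt_dotProduct (((S * T)ᵀ ^ ((k - 1) / 2)) *ᵥ ν.ofLp) μ).hasFDerivAt
    have h' : ∀ m : Vec n, (((S * T)ᵀ ^ ((k - 1) / 2)) *ᵥ ν.ofLp) ⬝ᵥ m.ofLp =
        ν.ofLp ⬝ᵥ ((S * T) ^ ((k - 1) / 2) *ᵥ m.ofLp) := by
      intro m
      rw [dotProduct_mulVec, ← mulVec_transpose, transpose_pow]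
    simp_rw [h'] at h
    refine (h.const_mul (k ! : ℝ)).congr_fderiv ?_
    ext v
    simp

lemma frobeniusPairing_apply (G H : Mat n) : frobeniusPairing G H = trace (Gᵀ * H) := rfl

/-- The power rule for `A ↦ f ((A T) ^ p)` in a noncommutative algebra. Being stated in an abstract
normed algebra, it applies to matrices with any norm inducing their topology. -/
lemma hasFDerivAt_apply_mul_pow {R : Type*} [NormedRing R] [NormedAlgebra ℝ R] (f D : R →L[ℝ] ℝ)
    (S T : R) (p : ℕ)
    (hD : ∀ H, D H = ∑ l ∈ Finset.range p, f ((S * T) ^ l * H * (T * (S * T) ^ (p - 1 - l)))) :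
    HasFDerivAt (fun A => f ((A * T) ^ p)) D S := by
  have h0 : HasFDerivAt (fun A : R => A * T) ((ContinuousLinearMap.mul ℝ R).flip T) S :=
    ((ContinuousLinearMap.mul ℝ R).flip T).hasFDerivAt
  refine (f.hasFDerivAt.comp S (h0.fun_pow' p)).congr_fderiv ?_
  ext1 H
  rw [hD, ← Finset.sum_range_reflect]
  simp only [ContinuousLinearMap.comp_apply, FunLike.coe_sum, Finset.sum_apply, map_sum]
  refine Finset.sum_congr rfl fun l hl => ?_
  have hl := Finset.mem_range.1 hl
  rw [show p.pred - (p - 1 - l) = l by rw [Nat.pred_eq_sub_one]; omega]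
  simp [mul_assoc]

lemma hasFDerivAt_apply_mul_pow_mul {R : Type*} [NormedRing R] [NormedAlgebra ℝ R]
    (f D : R →L[ℝ] ℝ) (S T : R) (p : ℕ)
    (hD : ∀ H, D H = ∑ l ∈ Finset.range p,
      f ((S * T) ^ l * H * (T * (S * T) ^ (p - 1 - l) * S)) + f ((S * T) ^ p * H)) :
    HasFDerivAt (fun A => f ((A * T) ^ p * A)) D S := by
  have h0 : HasFDerivAt (fun A : R => A * T) ((ContinuousLinearMap.mul ℝ R).flip T) S :=
    ((ContinuousLinearMap.mul ℝ R).flip T).hasFDerivAt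
  refine (f.hasFDerivAt.comp S ((h0.fun_pow' p).mul' (hasFDerivAt_id S))).congr_fderiv ?_
  ext1 H
  rw [hD, ← Finset.sum_range_reflect, add_comm]
  simp only [ContinuousLinearMap.comp_apply, FunLike.coe_sum, Finset.sum_apply, map_sum,
    FunLike.coe_add, Pi.add_apply, map_add, FunLike.coe_smul, Pi.smul_apply,
    MulOpposite.smul_eq_mul_unop, MulOpposite.unop_op, Finset.sum_mul]
  congr 1
  refine Finset.sum_congr rfl fun l hl => ?_
  have hl := Finset.mem_range.1 hl
  rw [show p.pred - (p - 1 - l) = l by rw [Nat.pred_eq_sub_one]; omega]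
  simp [mul_assoc]

-- Any norm inducing the product topology serves to differentiate functions of a matrix; this
-- one is submultiplicative.
attribute [local instance] Matrix.linftyOpNormedRing Matrix.linftyOpNormedAlgebra

lemma hasMatrixGradientAt_trace_mul_pow (C S T : Mat n) (p : ℕ) :
    HasMatrixGradientAt (fun A => trace (C * (A * T) ^ p))
      (∑ l ∈ Finset.range p, (T * (S * T) ^ (p - 1 - l) * C * (S * T) ^ l)ᵀ) S := by
  have h : ∀ H, frobeniusPairing (∑ l ∈ Finset.range p,
      (T * (S * T) ^ (p - 1 - l) * C * (S * T) ^ l)ᵀ) H = ∑ l ∈ Finset.range p,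
        frobeniusPairing Cᵀ ((S * T) ^ l * H * (T * (S * T) ^ (p - 1 - l))) := by
    intro H
    simp only [frobeniusPairing_apply, transpose_sum, transpose_transpose, Finset.sum_mul,
      trace_sum]
    refine Finset.sum_congr rfl fun l _ => ?_
    rw [← mul_assoc C, trace_mul_comm (C * _)]
    simp only [mul_assoc]
  have h1 := hasFDerivAt_apply_mul_pow (frobeniusPairing Cᵀ) _ S T p h
  exact h1

lemma hasMatrixGradientAt_trace_mul_pow_mul (C S T : Mat n) (p : ℕ) :
    HasMatrixGradientAt (fun A => trace (C * ((A * T) ^ p * A)))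
      (∑ l ∈ Finset.range p, (T * (S * T) ^ (p - 1 - l) * S * C * (S * T) ^ l)ᵀ +
        (C * (S * T) ^ p)ᵀ) S := by
  have h : ∀ H, frobeniusPairing (∑ l ∈ Finset.range p,
      (T * (S * T) ^ (p - 1 - l) * S * C * (S * T) ^ l)ᵀ + (C * (S * T) ^ p)ᵀ) H =
      ∑ l ∈ Finset.range p,
        frobeniusPairing Cᵀ ((S * T) ^ l * H * (T * (S * T) ^ (p - 1 - l) * S)) +
        frobeniusPairing Cᵀ ((S * T) ^ p * H) := by
    intro H
    simp only [frobeniusPairing_apply, transpose_add, transpose_sum, transpose_transpose,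
      Finset.sum_mul, add_mul, trace_add, trace_sum]
    congr 1
    · refine Finset.sum_congr rfl fun l _ => ?_
      rw [← mul_assoc C, trace_mul_comm (C * _)]
      simp only [mul_assoc]
    · rw [mul_assoc]
  have h1 := hasFDerivAt_apply_mul_pow_mul (frobeniusPairing Cᵀ) _ S T p h
  exact h1

lemma HasMatrixGradientAt.add {f g : Mat n → ℝ} {F G S : Mat n} (hf : HasMatrixGradientAt f F S)
    (hg : HasMatrixGradientAt g G S) : HasMatrixGradientAt (fun A => f A + g A) (F + G) S := by
  have h : frobeniusPairing (F + G) = frobeniusPairing F + frobeniusPairing G := by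
    ext1 H
    simp [frobeniusPairing_apply, add_mul]
  unfold HasMatrixGradientAt at *
  rw [h]
  exact HasFDerivAt.fun_add hf hg

lemma HasMatrixGradientAt.const_mul {f : Mat n → ℝ} {F S : Mat n} (hf : HasMatrixGradientAt f F S)
    (c : ℝ) : HasMatrixGradientAt (fun A => c * f A) (c • F) S := by
  have h : frobeniusPairing (c • F) = c • frobeniusPairing F := by
    ext1 H
    simp [frobeniusPairing_apply]
  unfold HasMatrixGradientAt at *
  rw [h]
  exact HasFDerivAt.const_mul hf c

lemma frobeniusPairing_sum {ι : Type*} (s : Finset ι) (c : ι → ℝ) (G : ι → Mat n) :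
    frobeniusPairing (∑ k ∈ s, c k • G k) = ∑ k ∈ s, c k • frobeniusPairing (G k) := by
  ext1 H
  simp [frobeniusPairing_apply, transpose_sum, Finset.sum_mul, trace_sum]

lemma dotProduct_mulVec_eq_trace (u v : Fin n → ℝ) (M : Mat n) :
    u ⬝ᵥ (M *ᵥ v) = trace (vecMulVec v u * M) := by
  rw [vecMulVec_mul, trace_vecMulVec, dotProduct_comm v, ← dotProduct_mulVec]

lemma hasMatrixGradientAt_kappa {S T : Mat n} (hS : S.IsSymm) (hT : T.IsSymm) (μ ν : Vec n)
    {k : ℕ} (hk1 : 1 ≤ k) :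
    HasMatrixGradientAt (fun A : Mat n => kappa μ A ν T k) (kappaGradCov μ S ν T k) S := by
  have htr : ∀ p, ((S * T)ᵀ) ^ p * T = T * (S * T) ^ p := transpose_pow_mul hS hT
  have hsymm : ∀ p, (T * (S * T) ^ p)ᵀ = T * (S * T) ^ p := fun p => (isSymm_mul_pow hS hT p).eq
  have hvv : ∀ u v : Fin n → ℝ, (vecMulVec u v)ᵀ = vecMulVec v u := fun u v =>
    transpose_vecMulVec u v
  rcases Nat.even_or_odd' k with ⟨m, rfl | rfl⟩
  · obtain ⟨p, rfl⟩ : ∃ p, m = p + 1 := ⟨m - 1, by omega⟩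
    have hk : Even (2 * (p + 1)) := even_two_mul _
    simp only [kappa, kappaGradCov, if_pos hk, matV, matVTilde]
    simp only [show 2 * (p + 1) / 2 = p + 1 by omega, show (2 * (p + 1) - 2) / 2 = p by omega,
      show (2 * (p + 1) - 4) / 2 = p - 1 by omega]
    have h1 := (hasMatrixGradientAt_trace_mul_pow 1 S T (p + 1)).const_mul
      (((2 * (p + 1) - 1)! : ℕ) : ℝ)
    have h2 := hasMatrixGradientAt_trace_mul_pow (vecMulVec μ.ofLp μ.ofLp * T) S T p
    have h3 := hasMatrixGradientAt_trace_mul_pow_mul (vecMulVec ν.ofLp ν.ofLp) S T p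
    have h := h1.add ((h2.add h3).const_mul ((((2 * (p + 1))! : ℕ) : ℝ) / 2))
    simp only [one_mul, mul_assoc (vecMulVec _ _) T, ← dotProduct_mulVec_eq_trace] at h
    convert h using 1
    congr 1
    · have h0 : ∀ l ∈ Finset.range (p + 1), (T * (S * T) ^ (p + 1 - 1 - l) * 1 * (S * T) ^ l)ᵀ =
          T * (S * T) ^ p := by
        intro l hl
        have hl := Finset.mem_range.1 hl
        rw [mul_one, mul_assoc, ← pow_add, show p + 1 - 1 - l + l = p by omega, hsymm]
      rw [Finset.sum_congr rfl h0, Finset.sum_const, Finset.card_range, ← Nat.cast_smul_eq_nsmul ℝ,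
        smul_smul]
      congr 1
      rw [show 2 * (p + 1) = 2 * p + 1 + 1 by ring, Nat.factorial_succ]
      push_cast [Nat.add_sub_cancel]
      ring
    · congr 2
      · refine Finset.sum_congr rfl fun l _ => ?_
        rw [transpose_mul, transpose_mul, transpose_mul, hsymm, transpose_pow, hT.eq, hvv,
          ← mul_assoc, ← mul_assoc, ← mul_assoc, htr]
      · rw [Finset.sum_range_succ]
        congr 1
        · refine Finset.sum_congr rfl fun l hl => ?_
          have hl := Finset.mem_range.1 hl
          rw [transpose_mul _ ((S * T) ^ l), transpose_mul _ (vecMulVec _ _), transpose_mul _ S,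
            hsymm, transpose_pow, hS.eq, hvv,
            ← mul_assoc S, show p - l = p - 1 - l + 1 by omega, pow_succ']
          simp only [mul_assoc]
        · rw [transpose_mul (vecMulVec _ _), transpose_pow, hvv]
          simp
  · have hk : ¬ Even (2 * m + 1) := by simp
    simp only [kappa, kappaGradCov, if_neg hk]
    simp only [show (2 * m + 1 - 1) / 2 = m by omega, show (2 * m + 1 - 3) / 2 = m - 1 by omega]
    have h := (hasMatrixGradientAt_trace_mul_pow (vecMulVec μ.ofLp ν.ofLp) S T m).const_mul
      (((2 * m + 1)! : ℕ) : ℝ)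
    simp only [← dotProduct_mulVec_eq_trace] at h
    convert h using 1
    congr 1
    refine Finset.sum_congr rfl fun l _ => ?_
    rw [transpose_mul _ ((S * T) ^ l), transpose_mul _ (vecMulVec _ _), hsymm, transpose_pow, hvv]
    simp only [mul_assoc]

end Gradients

/-! ### Gaussian expectations of polynomials -/

section GaussianMoments

lemma integrable_pow_gaussianReal (k : ℕ) : Integrable (fun x : ℝ => x ^ k) (gaussianReal 0 1) := by
  rcases Nat.eq_zero_or_pos k with rfl | hk
  · simp
  have h := (memLp_id_gaussianReal' (μ := 0) (v := 1) (k : ENNReal) (by simp)).integrable_norm_pow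
    hk.ne'
  refine h.mono' (by fun_prop) (Filter.Eventually.of_forall fun x => ?_)
  simp

/-- The `k`-th moment of the standard Gaussian law on `ℝ`. -/
def stdMoment (k : ℕ) : ℝ := ∫ x, x ^ k ∂(gaussianReal 0 1)

lemma stdMoment_zero : stdMoment 0 = 1 := by
  simp [stdMoment]

lemma integrable_pdf_mul_pow (k : ℕ) :
    Integrable (fun x : ℝ => gaussianPDFReal 0 1 x * x ^ k) := by
  have h := integrable_pow_gaussianReal k
  rw [gaussianReal_of_var_ne_zero _ one_ne_zero, integrable_withDensity_iff_integrable_smul'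
    (measurable_gaussianPDF 0 1) (Filter.Eventually.of_forall fun x => gaussianPDF_lt_top)] at h
  simpa [toReal_gaussianPDF] using h

/-- Integration by parts against the Gaussian density. -/
lemma stdMoment_succ (k : ℕ) : stdMoment (k + 1) = k * stdMoment (k - 1) := by
  have hpdf : ∀ x : ℝ, HasDerivAt (gaussianPDFReal 0 1) (-(gaussianPDFReal 0 1 x * x)) x := by
    intro x
    have h1 : HasDerivAt (fun x : ℝ => -(x - 0) ^ 2 / (2 * ((1 : NNReal) : ℝ))) (-x) x := by
      have := ((((hasDerivAt_id x).sub_const 0).pow 2).neg).div_const (2 * ((1 : NNReal) : ℝ))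
      refine this.congr_deriv ?_
      simp
      ring
    rw [gaussianPDFReal_def]
    refine (h1.exp.const_mul _).congr_deriv ?_
    ring
  have hpow : ∀ x : ℝ, HasDerivAt (fun x : ℝ => x ^ k) (k * x ^ (k - 1)) x := fun x =>
    hasDerivAt_pow k x
  have h := integral_mul_deriv_eq_deriv_mul_of_integrable
    (u := fun x : ℝ => x ^ k) (v := gaussianPDFReal 0 1)
    (fun x _ => hpow x) (fun x _ => hpdf x)
    (by
      refine (integrable_pdf_mul_pow (k + 1)).neg.congr (Filter.Eventually.of_forall fun x => ?_)
      simp only [Pi.mul_apply, Pi.neg_apply]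
      ring)
    (by
      refine ((integrable_pdf_mul_pow (k - 1)).const_mul (k : ℝ)).congr
        (Filter.Eventually.of_forall fun x => ?_)
      simp only [Pi.mul_apply]
      ring)
    (by
      refine (integrable_pdf_mul_pow k).congr (Filter.Eventually.of_forall fun x => ?_)
      simp only [Pi.mul_apply]
      ring)
  rw [stdMoment, stdMoment, integral_gaussianReal_eq_integral_smul one_ne_zero,
    integral_gaussianReal_eq_integral_smul one_ne_zero, ← integral_const_mul]
  simp only [smul_eq_mul]
  have e1 : ∀ x : ℝ, gaussianPDFReal 0 1 x * x ^ (k + 1) =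
      -(x ^ k * -(gaussianPDFReal 0 1 x * x)) := fun x => by ring
  have e2 : ∀ x : ℝ, (k : ℝ) * (gaussianPDFReal 0 1 x * x ^ (k - 1)) =
      k * x ^ (k - 1) * gaussianPDFReal 0 1 x := fun x => by ring
  simp_rw [e1, e2, integral_neg, h, neg_neg]

open MvPolynomial in
/-- The expectation of a polynomial in independent standard Gaussian variables, as a linear
functional determined by its values on monomials. -/
def stdExpectation (σ : Type*) [Fintype σ] : MvPolynomial σ ℝ →ₗ[ℝ] ℝ :=
  (basisMonomials σ ℝ).constr ℝ fun s => ∏ i, stdMoment (s i)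

section

variable {σ τ : Type*} [Fintype τ]

open MvPolynomial

lemma stdExpectation_monomial [Fintype σ] (s : σ →₀ ℕ) (a : ℝ) :
    stdExpectation σ (monomial s a) = a * ∏ i, stdMoment (s i) := by
  have h : monomial s a = a • basisMonomials σ ℝ s := by
    rw [coe_basisMonomials, smul_monomial, smul_eq_mul, mul_one]
  rw [h, map_smul, stdExpectation, Module.Basis.constr_basis, smul_eq_mul]

lemma stdExpectation_one [Fintype σ] : stdExpectation σ 1 = 1 := by
  rw [← C_1, ← monomial_zero', stdExpectation_monomial]
  simp [stdMoment_zero]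

lemma integrable_and_integral_eval_pi [Fintype σ] (p : MvPolynomial σ ℝ) :
    Integrable (fun x => eval x p) (Measure.pi fun _ : σ => gaussianReal 0 1) ∧
      ∫ x, eval x p ∂(Measure.pi fun _ : σ => gaussianReal 0 1) = stdExpectation σ p := by
  induction p using MvPolynomial.induction_on' with
  | monomial s a =>
    simp only [eval_monomial, Finsupp.prod_fintype _ _ (fun i => pow_zero _)]
    refine ⟨(Integrable.fintype_prod (f := fun i (x : ℝ) => x ^ s i)
      fun i => integrable_pow_gaussianReal (s i)).const_mul a, ?_⟩
    rw [integral_const_mul, integral_fintype_prod_eq_prod (f := fun i (x : ℝ) => x ^ s i),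
      stdExpectation_monomial]
    rfl
  | add p q hp hq =>
    simp only [map_add]
    exact ⟨hp.1.add hq.1, by rw [integral_add hp.1 hq.1, hp.2, hq.2]⟩

lemma stdExpectation_X_mul [Fintype σ] [DecidableEq σ] (i : σ) (p : MvPolynomial σ ℝ) :
    stdExpectation σ (X i * p) = stdExpectation σ (pderiv i p) := by
  induction p using MvPolynomial.induction_on' with
  | monomial s a =>
    rw [X, monomial_mul, pderiv_monomial, stdExpectation_monomial, stdExpectation_monomial,
      ← Finset.mul_prod_erase _ _ (Finset.mem_univ i),
      ← Finset.mul_prod_erase _ (fun j => stdMoment ((s - Finsupp.single i 1 : σ →₀ ℕ) j))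
        (Finset.mem_univ i)]
    have h1 : ∏ j ∈ Finset.univ.erase i, stdMoment ((Finsupp.single i 1 + s : σ →₀ ℕ) j) =
        ∏ j ∈ Finset.univ.erase i, stdMoment (s j) :=
      Finset.prod_congr rfl fun j hj => by
        simp [Finset.ne_of_mem_erase hj]
    have h2 : ∏ j ∈ Finset.univ.erase i, stdMoment ((s - Finsupp.single i 1 : σ →₀ ℕ) j) =
        ∏ j ∈ Finset.univ.erase i, stdMoment (s j) :=
      Finset.prod_congr rfl fun j hj => by
        simp [Finset.ne_of_mem_erase hj]
    rw [h1, h2]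
    simp only [Finsupp.add_apply, Finsupp.single_eq_same, Finsupp.tsub_apply]
    rw [add_comm 1, stdMoment_succ]
    ring
  | add p q hp hq => rw [mul_add, map_add, map_add, map_add, hp, hq]

/-- Independence: the expectation of a product of polynomials in disjoint sets of variables. -/
lemma stdExpectation_rename_mul_rename [Fintype σ] (p : MvPolynomial σ ℝ) (q : MvPolynomial τ ℝ) :
    stdExpectation (σ ⊕ τ) (rename Sum.inl p * rename Sum.inr q) =
      stdExpectation σ p * stdExpectation τ q := by
  induction p using MvPolynomial.induction_on' with
  | monomial s a =>
    induction q using MvPolynomial.induction_on' with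
    | monomial t b =>
      rw [rename_monomial, rename_monomial, monomial_mul, stdExpectation_monomial,
        stdExpectation_monomial, stdExpectation_monomial, Fintype.prod_sum_type]
      have h1 : ∀ i, (s.mapDomain Sum.inl + t.mapDomain Sum.inr : σ ⊕ τ →₀ ℕ) (Sum.inl i) =
          s i := by
        intro i
        rw [Finsupp.add_apply, Finsupp.mapDomain_apply Sum.inl_injective,
          Finsupp.mapDomain_of_notMem_range _ _ (by simp), add_zero]
      have h2 : ∀ i, (s.mapDomain Sum.inl + t.mapDomain Sum.inr : σ ⊕ τ →₀ ℕ) (Sum.inr i) =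
          t i := by
        intro i
        rw [Finsupp.add_apply, Finsupp.mapDomain_apply Sum.inr_injective,
          Finsupp.mapDomain_of_notMem_range _ _ (by simp), zero_add]
      simp only [h1, h2]
      ring
    | add q q' hq hq' => rw [map_add, mul_add, map_add, map_add, mul_add, hq, hq']
  | add p p' hp hp' => rw [map_add, add_mul, map_add, map_add, add_mul, hp, hp']

/-- The polynomials that are the coordinates of the affine map `ξ ↦ θ + R ξ`. -/
def affineCoord (θ : σ → ℝ) (R : Matrix σ τ ℝ) (i : σ) : MvPolynomial τ ℝ :=
  C (θ i) + ∑ k, C (R i k) * X k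

/-- The expectation of a polynomial in the coordinates of `θ + R ξ`, for `ξ` standard Gaussian. -/
def affineExpectation (θ : σ → ℝ) (R : Matrix σ τ ℝ) : MvPolynomial σ ℝ →ₗ[ℝ] ℝ :=
  (stdExpectation τ).comp (aeval (affineCoord θ R)).toLinearMap

lemma affineExpectation_apply (θ : σ → ℝ) (R : Matrix σ τ ℝ) (p : MvPolynomial σ ℝ) :
    affineExpectation θ R p = stdExpectation τ (aeval (affineCoord θ R) p) := rfl

lemma affineExpectation_one (θ : σ → ℝ) (R : Matrix σ τ ℝ) : affineExpectation θ R 1 = 1 := by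
  rw [affineExpectation_apply, map_one, stdExpectation_one]

lemma pderiv_aeval_affineCoord [Fintype σ] [DecidableEq σ] [DecidableEq τ] (θ : σ → ℝ)
    (R : Matrix σ τ ℝ) (k : τ) (p : MvPolynomial σ ℝ) :
    pderiv k (aeval (affineCoord θ R) p) =
      ∑ j, R j k • aeval (affineCoord θ R) (pderiv j p) := by
  induction p using MvPolynomial.induction_on with
  | C a => simp
  | add p q hp hq => simp only [map_add, hp, hq, smul_add, Finset.sum_add_distrib]
  | mul_X p i hp =>
    have h : pderiv k (affineCoord θ R i) = C (R i k) := by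
      simp [affineCoord, pderiv_X, Pi.single_apply, Derivation.leibniz]
    have h2 : ∀ j, R j k • aeval (affineCoord θ R) (pderiv j (p * X i)) =
        (if i = j then C (R j k) * aeval (affineCoord θ R) p else 0) +
          affineCoord θ R i * R j k • aeval (affineCoord θ R) (pderiv j p) := by
      intro j
      rw [Derivation.leibniz, pderiv_X, Pi.single_apply, map_add, smul_add, smul_eq_mul,
        smul_eq_mul, map_mul, map_mul, aeval_X, mul_smul_comm]
      congr 1
      split_ifs <;> simp [smul_eq_C_mul]
    rw [map_mul, aeval_X, Derivation.leibniz, h, hp]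
    simp only [h2, Finset.sum_add_distrib, Finset.sum_ite_eq, Finset.mem_univ, if_true, smul_eq_mul,
      Finset.mul_sum]
    rw [mul_comm]

/-- Stein's identity for the Gaussian law with mean `θ` and covariance `R R'`, on polynomials. -/
lemma affineExpectation_X_mul [Fintype σ] [DecidableEq σ] [DecidableEq τ] (θ : σ → ℝ)
    (R : Matrix σ τ ℝ) (i : σ) (p : MvPolynomial σ ℝ) :
    affineExpectation θ R (X i * p) = θ i * affineExpectation θ R p +
      ∑ j, (R * Rᵀ) i j * affineExpectation θ R (pderiv j p) := by
  simp only [affineExpectation_apply]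
  rw [map_mul, aeval_X, affineCoord, add_mul, Finset.sum_mul, map_add, map_sum, ← smul_eq_C_mul,
    map_smul, smul_eq_mul]
  congr 1
  have h : ∀ k, stdExpectation τ (C (R i k) * X k * aeval (affineCoord θ R) p) =
      ∑ j, R i k * R j k * stdExpectation τ (aeval (affineCoord θ R) (pderiv j p)) := by
    intro k
    rw [mul_assoc, ← smul_eq_C_mul, map_smul, stdExpectation_X_mul, pderiv_aeval_affineCoord,
      map_sum, smul_eq_mul, Finset.mul_sum]
    exact Finset.sum_congr rfl fun j _ => by rw [map_smul, smul_eq_mul, mul_assoc]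
  simp_rw [h]
  rw [Finset.sum_comm]
  refine Finset.sum_congr rfl fun j _ => ?_
  rw [mul_apply, Finset.sum_mul]
  rfl

lemma affineExpectation_rename_mul_rename {σ' τ' : Type*} [Fintype τ']
    (θ : σ → ℝ) (η : σ' → ℝ) (R : Matrix σ τ ℝ) (Q : Matrix σ' τ' ℝ)
    (p : MvPolynomial σ ℝ) (q : MvPolynomial σ' ℝ) :
    affineExpectation (Sum.elim θ η) (fromBlocks R 0 0 Q) (rename Sum.inl p * rename Sum.inr q) =
      affineExpectation θ R p * affineExpectation η Q q := by
  have h1 : aeval (affineCoord (Sum.elim θ η) (fromBlocks R 0 0 Q)) (rename Sum.inl p) =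
      rename Sum.inl (aeval (affineCoord θ R) p) := by
    rw [aeval_rename, ← AlgHom.comp_apply, comp_aeval]
    congr 2
    funext i
    simp [affineCoord]
  have h2 : aeval (affineCoord (Sum.elim θ η) (fromBlocks R 0 0 Q)) (rename Sum.inr q) =
      rename Sum.inr (aeval (affineCoord η Q) q) := by
    rw [aeval_rename, ← AlgHom.comp_apply, comp_aeval]
    congr 2
    funext i
    simp [affineCoord]
  rw [affineExpectation_apply, map_mul, h1, h2, stdExpectation_rename_mul_rename]
  rfl

open scoped MatrixOrder in
lemma integral_eval_multivariateGaussian {n : ℕ} (μ : Vec n) (S : Mat n)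
    (p : MvPolynomial (Fin n) ℝ) :
    ∫ x, eval x.ofLp p ∂(multivariateGaussian μ S) =
      affineExpectation μ.ofLp (CFC.sqrt S) p := by
  have hmeas : Measurable fun x : Vec n => eval x.ofLp p := by
    have h : Continuous fun x : Fin n → ℝ => eval x p := MvPolynomial.continuous_eval p
    exact (h.comp (PiLp.continuous_ofLp 2 _)).measurable
  have hcomp : Measurable fun x : Vec n =>
      eval (μ + toEuclideanCLM (𝕜 := ℝ) (CFC.sqrt S) x).ofLp p := hmeas.comp (by fun_prop)
  rw [multivariateGaussian, integral_map (by fun_prop) hmeas.aestronglyMeasurable,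
    ← map_pi_eq_stdGaussian, integral_map (by fun_prop)
      hcomp.aestronglyMeasurable, affineExpectation_apply,
    ← (integrable_and_integral_eval_pi _).2]
  refine integral_congr_ae (Filter.Eventually.of_forall fun x => ?_)
  simp only
  rw [← MvPolynomial.coe_aeval_eq_eval, ← MvPolynomial.coe_aeval_eq_eval]
  change _ = aeval x (aeval _ p)
  rw [← AlgHom.comp_apply, comp_aeval]
  change aeval _ p = _
  congr 2
  funext i
  simp [affineCoord, mulVec, dotProduct]

end

end GaussianMoments

/-! ### Moments of a Gaussian quadratic form -/

section QuadraticForm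

open MvPolynomial

variable {σ : Type*} [Fintype σ] [DecidableEq σ]

/-- The recursion for the moments of the quadratic form `q = w'Jw / 2` of a Gaussian vector `w` with
mean `θ` and covariance `Ω`. Stein's identity expresses the tensors `L d = E(w q^d) / d!` and
`P d = E(w w' q^d) / d!` through `m d = E(q^d) / d!` and their predecessors; solving these linear
recursions and taking the trace of `J P d` gives `E(q^(d+1))`. -/
lemma quadraticForm_moment_succ {F : MvPolynomial σ ℝ →ₗ[ℝ] ℝ} {θ : σ → ℝ} {Ω J : Matrix σ σ ℝ}
    (hF : ∀ i p, F (X i * p) = θ i * F p + ∑ j, Ω i j * F (pderiv j p))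
    (hΩ : Ω.IsSymm) (hJ : J.IsSymm) {q : MvPolynomial σ ℝ}
    (hq : ∑ i, ∑ j, J i j • (X i * X j) = (2 : ℝ) • q)
    (hdq : ∀ i, pderiv i q = ∑ j, J i j • X j) (d : ℕ) :
    2 * F (q ^ (d + 1)) = ∑ k ∈ Finset.range (d + 1), ((d ! : ℝ) / ((d - k)! : ℝ)) *
      ((k + 1) * (θ ⬝ᵥ (((J * Ω) ^ k * J) *ᵥ θ)) + trace ((J * Ω) ^ (k + 1))) *
        F (q ^ (d - k)) := by
  set N := Ω * J with hN
  set m : ℕ → ℝ := fun d => F (q ^ d) / (d ! : ℝ) with hm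
  set L : ℕ → σ → ℝ := fun d i => F (X i * q ^ d) / (d ! : ℝ) with hL
  set P : ℕ → Matrix σ σ ℝ := fun d =>
    Matrix.of fun i j => F (X i * (X j * q ^ d)) / (d ! : ℝ) with hP
  have hfac : ∀ d : ℕ, (d ! : ℝ) ≠ 0 := fun d => by exact_mod_cast Nat.factorial_ne_zero d
  have hpow : ∀ j, ∀ d : ℕ, pderiv j (q ^ (d + 1)) =
      ((d : ℝ) + 1) • ∑ l, J j l • (X l * q ^ d) := by
    intro j d
    rw [Derivation.leibniz_pow, hdq, Nat.add_sub_cancel, ← Nat.cast_smul_eq_nsmul ℝ]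
    push_cast
    congr 1
    rw [smul_eq_mul, Finset.mul_sum]
    exact Finset.sum_congr rfl fun l _ => by rw [mul_smul_comm, mul_comm]
  have hL0 : L 0 = m 0 • θ := by
    funext i
    simp only [hL, hm, pow_zero, Pi.smul_apply, smul_eq_mul]
    rw [hF]
    simp [mul_comm]
  have hLs : ∀ d, L (d + 1) = m (d + 1) • θ + N *ᵥ L d := by
    intro d
    funext i
    simp only [hL, hm, Pi.add_apply, Pi.smul_apply, smul_eq_mul, hN, ← mulVec_mulVec]
    rw [hF, add_div]
    congr 1
    · ring
    · simp only [mulVec, dotProduct]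
      rw [Finset.sum_div]
      refine Finset.sum_congr rfl fun j _ => ?_
      rw [hpow, map_smul, map_sum, smul_eq_mul, mul_div_assoc]
      congr 1
      rw [Finset.mul_sum, Finset.sum_div]
      refine Finset.sum_congr rfl fun l _ => ?_
      rw [map_smul, smul_eq_mul, Nat.factorial_succ]
      have := hfac d
      push_cast
      field_simp
  have hPsymm : ∀ d, (P d).IsSymm := by
    intro d
    ext i j
    simp only [hP, transpose_apply, of_apply]
    rw [mul_left_comm]
  have hP0 : P 0 = vecMulVec θ (L 0) + m 0 • Ω := by
    ext i j
    simp only [hP, hL, hm, of_apply, pow_zero, Matrix.add_apply, Matrix.smul_apply, vecMulVec_apply]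
    rw [hF]
    simp [pderiv_X, Pi.single_apply, apply_ite]
    ring
  have hPs : ∀ d, P (d + 1) = vecMulVec θ (L (d + 1)) + m (d + 1) • Ω + N * P d := by
    intro d
    ext i j
    have hd : ∀ k, F (pderiv k (X j * q ^ (d + 1))) =
        (if k = j then F (q ^ (d + 1)) else 0) +
          ((d : ℝ) + 1) * ∑ l, J k l * F (X l * (X j * q ^ d)) := by
      intro k
      rw [Derivation.leibniz, hpow, pderiv_X, map_add, add_comm, smul_eq_mul, smul_eq_mul,
        mul_smul_comm, map_smul, Finset.mul_sum, map_sum]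
      congr 1
      · by_cases hk : k = j
        · subst hk; simp
        · simp [hk]
      · rw [smul_eq_mul]
        congr 1
        refine Finset.sum_congr rfl fun l _ => ?_
        rw [mul_smul_comm, map_smul, smul_eq_mul, mul_left_comm (X j)]
    simp only [hP, of_apply]
    rw [hF]
    simp only [hd, mul_add, Finset.sum_add_distrib]
    simp only [hL, hm, hN, Matrix.add_apply, Matrix.smul_apply, vecMulVec_apply, smul_eq_mul,
      mul_assoc Ω, Matrix.mul_apply, of_apply, mul_ite, mul_zero, Finset.sum_ite_eq',
      Finset.mem_univ, if_true]
    rw [add_div, add_div, ← add_assoc]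
    congr 1
    · ring
    · rw [Finset.sum_div]
      refine Finset.sum_congr rfl fun k _ => ?_
      rw [mul_div_assoc]
      congr 1
      rw [Finset.mul_sum, Finset.sum_div]
      refine Finset.sum_congr rfl fun l _ => ?_
      rw [Nat.factorial_succ]
      have := hfac d
      push_cast
      field_simp
  -- `L d` and `P d` are convolutions of `m` with the fixed sequences `N ^ k θ` and `A k`
  have hLsol : ∀ d, L d = ∑ k ∈ Finset.range (d + 1), m (d - k) • (N ^ k *ᵥ θ) := by
    intro d
    induction d with
    | zero => simp [hL0]
    | succ d ih =>
      rw [hLs, ih, Finset.sum_range_succ' _ (d + 1), add_comm, mulVec_sum]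
      congr 1
      · refine Finset.sum_congr rfl fun k _ => ?_
        rw [mulVec_smul, mulVec_mulVec, ← pow_succ', Nat.add_sub_add_right]
      · simp
  set A : ℕ → Matrix σ σ ℝ := fun k =>
    ∑ j ∈ Finset.range (k + 1), N ^ j * vecMulVec θ (N ^ (k - j) *ᵥ θ) + N ^ k * Ω with hA
  have hAs : ∀ k, A (k + 1) = vecMulVec θ (N ^ (k + 1) *ᵥ θ) + N * A k := by
    intro k
    simp only [hA]
    rw [Finset.sum_range_succ' _ (k + 1), mul_add, Finset.mul_sum, pow_succ' N k]
    simp only [Nat.add_sub_add_right, pow_succ' N, pow_zero, one_mul, mul_assoc, Nat.sub_zero]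
    abel
  have hPsol : ∀ d, P d = ∑ k ∈ Finset.range (d + 1), m (d - k) • A k := by
    intro d
    induction d with
    | zero =>
      rw [hP0, hL0]
      simp [hA, vecMulVec_smul]
    | succ d ih =>
      have h0 : vecMulVec θ (L (d + 1)) =
          ∑ k ∈ Finset.range (d + 1), m (d - k) • vecMulVec θ (N ^ (k + 1) *ᵥ θ) +
            m (d + 1) • vecMulVec θ θ := by
        rw [hLsol, Finset.sum_range_succ' _ (d + 1)]
        ext i j
        simp [vecMulVec_apply, Finset.sum_apply, Matrix.sum_apply, Finset.mul_sum, mul_add,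
          mul_left_comm]
      rw [hPs, ih, Finset.sum_range_succ' _ (d + 1), h0, Finset.mul_sum]
      simp only [hAs, smul_add, Finset.sum_add_distrib, Nat.add_sub_add_right, mul_smul_comm,
        Nat.sub_zero]
      simp only [hA, zero_add, Finset.sum_range_one, pow_zero, one_mul, Nat.sub_zero, one_mulVec,
        smul_add]
      abel
  have hJN : ∀ k, J * N ^ k = (J * Ω) ^ k * J := by
    intro k
    induction k with
    | zero => simp
    | succ k ih => rw [pow_succ, ← mul_assoc, ih, pow_succ, hN]; simp only [mul_assoc]
  have htrA : ∀ k : ℕ, trace (J * A k) =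
      (k + 1) * (θ ⬝ᵥ (((J * Ω) ^ k * J) *ᵥ θ)) + trace ((J * Ω) ^ (k + 1)) := by
    intro k
    simp only [hA]
    rw [mul_add, trace_add, Finset.mul_sum, trace_sum, ← mul_assoc, hJN, mul_assoc, ← pow_succ]
    congr 1
    have h0 : ∀ j ∈ Finset.range (k + 1), trace (J * (N ^ j * vecMulVec θ (N ^ (k - j) *ᵥ θ))) =
        θ ⬝ᵥ (((J * Ω) ^ k * J) *ᵥ θ) := by
      intro j hj
      have hj := Finset.mem_range.1 hj
      have hNt : (N ^ (k - j))ᵀ = (J * Ω) ^ (k - j) := by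
        rw [transpose_pow, hN, transpose_mul, hΩ.eq, hJ.eq]
      rw [← mul_assoc, hJN, mul_vecMulVec, trace_vecMulVec, dotProduct_comm, ← vecMul_transpose,
        ← dotProduct_mulVec, hNt, mulVec_mulVec, ← mul_assoc, ← pow_add,
        show k - j + j = k by omega]
    rw [Finset.sum_congr rfl h0, Finset.sum_const, Finset.card_range, nsmul_eq_mul]
    push_cast
    ring
  have hq2 : 2 * F (q ^ (d + 1)) = (d ! : ℝ) * trace (J * P d) := by
    have h1 : (2 : ℝ) • q ^ (d + 1) = ∑ i, ∑ j, J i j • (X j * (X i * q ^ d)) := by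
      rw [pow_succ', ← smul_mul_assoc, ← hq, Finset.sum_mul]
      refine Finset.sum_congr rfl fun i _ => ?_
      rw [Finset.sum_mul]
      refine Finset.sum_congr rfl fun j _ => ?_
      rw [smul_mul_assoc]
      congr 1
      ring
    rw [← smul_eq_mul, ← map_smul, h1, map_sum, trace, Finset.mul_sum]
    refine Finset.sum_congr rfl fun i _ => ?_
    rw [map_sum, diag_apply, mul_apply, Finset.mul_sum]
    refine Finset.sum_congr rfl fun j _ => ?_
    simp only [hP, of_apply]
    rw [map_smul, smul_eq_mul]
    have := hfac d
    field_simp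
  rw [hq2, hPsol, Finset.mul_sum, trace_sum, Finset.mul_sum]
  refine Finset.sum_congr rfl fun k _ => ?_
  rw [mul_smul_comm, trace_smul, htrA, smul_eq_mul, hm]
  ring

/-- The moments of a Gaussian quadratic form are the complete Bell polynomials in its
cumulants. -/
lemma quadraticForm_moment_eq_bell {F : MvPolynomial σ ℝ →ₗ[ℝ] ℝ} {θ : σ → ℝ} {Ω J : Matrix σ σ ℝ}
    (hF1 : F 1 = 1)
    (hF : ∀ i p, F (X i * p) = θ i * F p + ∑ j, Ω i j * F (pderiv j p))
    (hΩ : Ω.IsSymm) (hJ : J.IsSymm) {q : MvPolynomial σ ℝ}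
    (hq : ∑ i, ∑ j, J i j • (X i * X j) = (2 : ℝ) • q)
    (hdq : ∀ i, pderiv i q = ∑ j, J i j • X j) {x : ℕ → ℝ}
    (hx : ∀ k : ℕ, x (k + 1) = (k ! : ℝ) / 2 *
      ((k + 1) * (θ ⬝ᵥ (((J * Ω) ^ k * J) *ᵥ θ)) + trace ((J * Ω) ^ (k + 1)))) (d : ℕ) :
    F (q ^ d) = bell d x := by
  induction d using Nat.strong_induction_on with
  | _ d ih =>
    rcases d with _ | d
    · rw [pow_zero, hF1, bell_zero]
    have h := quadraticForm_moment_succ hF hΩ hJ hq hdq d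
    rw [bell_succ]
    have h2 : F (q ^ (d + 1)) = 2⁻¹ * (2 * F (q ^ (d + 1))) := by ring
    rw [h2, h, Finset.mul_sum]
    refine Finset.sum_congr rfl fun k hk => ?_
    have hk := Finset.mem_range.1 hk
    rw [ih (d - k) (by omega), hx, Nat.cast_choose ℝ (by omega : k ≤ d)]
    have h1 : (k ! : ℝ) ≠ 0 := by exact_mod_cast Nat.factorial_ne_zero k
    have h3 : ((d - k)! : ℝ) ≠ 0 := by exact_mod_cast Nat.factorial_ne_zero (d - k)
    field_simp

end QuadraticForm

/-! ### The inner product of Gaussian moment tensors -/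

section InnerProduct

open MvPolynomial

variable {n : ℕ}

open scoped MatrixOrder in
lemma momentTensor_eq (d : ℕ) (μ : Vec n) (S : Mat n) (i : Fin d → Fin n) :
    momentTensor d μ S i = affineExpectation μ.ofLp (CFC.sqrt S) (∏ r, X (i r)) := by
  rw [← integral_eval_multivariateGaussian]
  simp [momentTensor, map_prod]

/-- The polynomial `∑ x_i y_i` in the variables `x_i` (left summand) and `y_i` (right summand). -/
def dotPoly (n : ℕ) : MvPolynomial (Fin n ⊕ Fin n) ℝ := ∑ i, X (Sum.inl i) * X (Sum.inr i)

open scoped MatrixOrder in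
/-- `⟨E X^{⊗d}, E Y^{⊗d}⟩ = E (X ⬝ Y)^d` for independent `X ∼ N(μ, S)`, `Y ∼ N(ν, T)`. -/
lemma psi_eq_affineExpectation (d : ℕ) (μ : Vec n) (S : Mat n) (ν : Vec n) (T : Mat n) :
    Psi d μ S ν T = affineExpectation (Sum.elim μ.ofLp ν.ofLp)
      (fromBlocks (CFC.sqrt S) 0 0 (CFC.sqrt T)) (dotPoly n ^ d) := by
  rw [dotPoly, Fintype.sum_pow, map_sum, Psi]
  refine Finset.sum_congr rfl fun i _ => ?_
  rw [momentTensor_eq, momentTensor_eq, ← affineExpectation_rename_mul_rename, map_prod, map_prod,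
    ← Finset.prod_mul_distrib]
  simp only [rename_X]

/-- The symmetric matrix with `x ⬝ y = w'Jw / 2` for `w = (x, y)`. -/
def swapMatrix (n : ℕ) : Matrix (Fin n ⊕ Fin n) (Fin n ⊕ Fin n) ℝ := fromBlocks 0 1 1 0

lemma swapMatrix_mul (S T : Mat n) : swapMatrix n * fromBlocks S 0 0 T = fromBlocks 0 T S 0 := by
  simp [swapMatrix, fromBlocks_multiply]

lemma antidiag_pow_even (S T : Mat n) (p : ℕ) :
    (fromBlocks 0 T S 0 : Matrix (Fin n ⊕ Fin n) (Fin n ⊕ Fin n) ℝ) ^ (2 * p) =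
      fromBlocks ((T * S) ^ p) 0 0 ((S * T) ^ p) := by
  induction p with
  | zero => simp
  | succ p ih => rw [mul_add, mul_one, pow_add, ih, pow_two]; simp [fromBlocks_multiply, pow_succ]

lemma antidiag_pow_odd (S T : Mat n) (p : ℕ) :
    (fromBlocks 0 T S 0 : Matrix (Fin n ⊕ Fin n) (Fin n ⊕ Fin n) ℝ) ^ (2 * p + 1) =
      fromBlocks 0 ((T * S) ^ p * T) ((S * T) ^ p * S) 0 := by
  rw [pow_succ, antidiag_pow_even]
  simp [fromBlocks_multiply]

lemma sumElim_dotProduct_mulVec (u v : Fin n → ℝ) (A B C D : Mat n) :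
    Sum.elim u v ⬝ᵥ (fromBlocks A B C D *ᵥ Sum.elim u v) =
      u ⬝ᵥ (A *ᵥ u + B *ᵥ v) + v ⬝ᵥ (C *ᵥ u + D *ᵥ v) := by
  rw [fromBlocks_mulVec, sumElim_dotProduct_sumElim]
  simp

lemma trace_fromBlocks_eq (A B C D : Mat n) : trace (fromBlocks A B C D) = trace A + trace D := by
  simp [trace]

/-- The numbers `κ_k` are the cumulants of `X ⬝ Y`, viewed as a quadratic form in `(X, Y)`. -/
lemma kappa_succ {S T : Mat n} (hS : S.IsSymm) (hT : T.IsSymm) (μ ν : Vec n) (k : ℕ) :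
    kappa μ S ν T (k + 1) = (k ! : ℝ) / 2 *
      ((k + 1) * (Sum.elim μ.ofLp ν.ofLp ⬝ᵥ
        (((swapMatrix n * fromBlocks S 0 0 T) ^ k * swapMatrix n) *ᵥ Sum.elim μ.ofLp ν.ofLp)) +
        trace ((swapMatrix n * fromBlocks S 0 0 T) ^ (k + 1))) := by
  rw [swapMatrix_mul]
  rcases Nat.even_or_odd' k with ⟨p, rfl | rfl⟩
  · have hodd : ¬ Even (2 * p + 1) := by simp
    have hdual : μ.ofLp ⬝ᵥ ((T * S) ^ p *ᵥ ν.ofLp) = ν.ofLp ⬝ᵥ ((S * T) ^ p *ᵥ μ.ofLp) := by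
      rw [dotProduct_mulVec, ← mulVec_transpose, transpose_pow, transpose_mul, hS.eq, hT.eq,
        dotProduct_comm]
    rw [antidiag_pow_odd, antidiag_pow_even, swapMatrix, fromBlocks_multiply, trace_fromBlocks_eq,
      kappa, if_neg hodd, show (2 * p + 1 - 1) / 2 = p by omega]
    simp only [mul_zero, mul_one, add_zero, zero_add, trace_zero,
      sumElim_dotProduct_mulVec, zero_mulVec]
    rw [hdual, Nat.factorial_succ]
    push_cast
    ring
  · have heven : Even (2 * (p + 1)) := even_two_mul _
    have hshift : (T * S) ^ p * T = T * (S * T) ^ p := by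
      rw [← transpose_pow_mul hS hT, transpose_mul, hS.eq, hT.eq]
    have htrace : trace ((T * S) ^ (p + 1)) = trace ((S * T) ^ (p + 1)) := by
      rw [← trace_transpose, transpose_pow, transpose_mul, hS.eq, hT.eq]
    rw [show 2 * p + 1 + 1 = 2 * (p + 1) by ring, antidiag_pow_odd, antidiag_pow_even, swapMatrix,
      fromBlocks_multiply, trace_fromBlocks_eq, kappa, if_pos heven,
      show (2 * (p + 1) - 2) / 2 = p by omega, show 2 * (p + 1) / 2 = p + 1 by omega,
      show 2 * (p + 1) - 1 = 2 * p + 1 by omega, show 2 * (p + 1) = 2 * p + 1 + 1 by ring,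
      Nat.factorial_succ (2 * p + 1)]
    simp only [mul_zero, mul_one, add_zero, zero_add,
      sumElim_dotProduct_mulVec, zero_mulVec]
    rw [htrace, hshift]
    push_cast
    ring

open scoped MatrixOrder in
lemma psi_eq_bell {S T : Mat n} (hS : S.PosSemidef) (hT : T.PosSemidef) (d : ℕ) (μ ν : Vec n) :
    Psi d μ S ν T = bell d (kappa μ S ν T) := by
  have hSs : S.IsSymm := isHermitian_iff_isSymm.1 hS.1
  have hTs : T.IsSymm := isHermitian_iff_isSymm.1 hT.1
  have hsqrt : ∀ A : Mat n, A.PosSemidef → CFC.sqrt A * (CFC.sqrt A)ᵀ = A := by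
    intro A hA
    have h : (CFC.sqrt A)ᵀ = CFC.sqrt A := by
      have := (CFC.sqrt_nonneg A).isSelfAdjoint.star_eq
      rwa [star_eq_conjTranspose, conjTranspose_eq_transpose_of_trivial] at this
    rw [h, CFC.sqrt_mul_sqrt_self A hA.nonneg]
  rw [psi_eq_affineExpectation]
  refine quadraticForm_moment_eq_bell (Ω := fromBlocks S 0 0 T) (J := swapMatrix n)
    (affineExpectation_one _ _) (fun i p => ?_) ?_ ?_ ?_ (fun i => ?_) (kappa_succ hSs hTs μ ν) d
  · rw [affineExpectation_X_mul, fromBlocks_transpose, fromBlocks_multiply]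
    simp [hsqrt S hS, hsqrt T hT]
  · rw [IsSymm, fromBlocks_transpose, hSs.eq, hTs.eq]
    simp
  · rw [IsSymm, swapMatrix, fromBlocks_transpose]
    simp
  · simp [swapMatrix, dotPoly, Matrix.one_apply, two_smul, mul_comm, ite_smul]
  · rcases i with i | i <;>
      simp [swapMatrix, dotPoly, Matrix.one_apply, pderiv_X, Pi.single_apply, ite_smul,
        Derivation.leibniz]

end InnerProduct

attribute [local instance] Matrix.linftyOpNormedRing Matrix.linftyOpNormedAlgebra in
lemma hasMatrixGradientAt_bell_kappa {n : ℕ} {S T : Mat n} (hS : S.IsSymm) (hT : T.IsSymm)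
    (μ ν : Vec n) (d : ℕ) :
    HasMatrixGradientAt (fun A : Mat n => bell d (kappa μ A ν T))
      (∑ k ∈ Finset.Icc 1 d,
        ((d.choose k : ℝ) * bell (d - k) (kappa μ S ν T)) • kappaGradCov μ S ν T k) S := by
  unfold HasMatrixGradientAt
  rw [frobeniusPairing_sum]
  exact hasFDerivAt_bell (fun k hk => hasMatrixGradientAt_kappa hS hT μ ν hk) d

lemma hasGradientAt_bell_kappa {n : ℕ} {S T : Mat n} (hS : S.IsSymm) (hT : T.IsSymm)
    (μ ν : Vec n) (d : ℕ) :
    HasGradientAt (fun m : Vec n => bell d (kappa m S ν T))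
      (∑ k ∈ Finset.Icc 1 d,
        ((d.choose k : ℝ) * bell (d - k) (kappa μ S ν T)) • kappaGradMean μ S ν T k) μ := by
  rw [hasGradientAt_iff_hasFDerivAt]
  refine (hasFDerivAt_bell (fun k _ => (hasGradientAt_kappa hS hT μ ν k).hasFDerivAt)
    d).congr_fderiv ?_
  simp [map_sum]

end GaussianInner
end

open GaussianInner in
theorem mainTheorem12 (n d : ℕ) (μ ν : Vec n) (S T : Mat n) (hS : S.IsSymm) (hT : T.IsSymm) :
    -- the derivatives of the numbers `κ_k`
    (∀ k : ℕ, 1 ≤ k →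
      HasGradientAt (fun m : Vec n => kappa m S ν T k) (kappaGradMean μ S ν T k) μ ∧
      HasMatrixGradientAt (fun A : Mat n => kappa μ A ν T k) (kappaGradCov μ S ν T k) S) ∧
    -- the derivatives of the polynomial `B_d(κ₁, …, κ_d)`, all entries of the matrix being free
    HasGradientAt (fun m : Vec n => bell d (kappa m S ν T))
      (∑ k ∈ Finset.Icc 1 d,
        ((d.choose k : ℝ) * bell (d - k) (kappa μ S ν T)) • kappaGradMean μ S ν T k) μ ∧
    HasMatrixGradientAt (fun A : Mat n => bell d (kappa μ A ν T))
      (∑ k ∈ Finset.Icc 1 d,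
        ((d.choose k : ℝ) * bell (d - k) (kappa μ S ν T)) • kappaGradCov μ S ν T k) S ∧
    -- for covariance matrices, this polynomial is the inner product of the Gaussian moments,
    -- which therefore has the same derivatives
    (S.PosSemidef → T.PosSemidef →
      Psi d μ S ν T = bell d (kappa μ S ν T) ∧
      HasGradientAt (fun m : Vec n => Psi d m S ν T)
        (∑ k ∈ Finset.Icc 1 d,
          ((d.choose k : ℝ) * bell (d - k) (kappa μ S ν T)) • kappaGradMean μ S ν T k) μ ∧
      HasMatrixGradientWithinAt (fun A : Mat n => Psi d μ A ν T)
        (∑ k ∈ Finset.Icc 1 d,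
          ((d.choose k : ℝ) * bell (d - k) (kappa μ S ν T)) • kappaGradCov μ S ν T k)
        {A : Mat n | A.PosSemidef} S) := by
  refine ⟨fun k hk => ⟨hasGradientAt_kappa hS hT μ ν k, hasMatrixGradientAt_kappa hS hT μ ν hk⟩,
    hasGradientAt_bell_kappa hS hT μ ν d, hasMatrixGradientAt_bell_kappa hS hT μ ν d,
    fun hSp hTp => ⟨psi_eq_bell hSp hTp d μ ν, ?_, ?_⟩⟩
  · simp_rw [psi_eq_bell hSp hTp]
    exact hasGradientAt_bell_kappa hS hT μ ν d
  · -- off the cone `multivariateGaussian` is a Dirac mass and the equality may fail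
    have h := hasMatrixGradientAt_bell_kappa hS hT μ ν d
    exact h.hasFDerivWithinAt.congr (fun A hA => psi_eq_bell hA hTp d μ ν)
      (psi_eq_bell hSp hTp d μ ν)
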